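/- Let $p,q\ge 0$ be integers with $p-q\equiv 1 \pmod 4$, and let $Cl_{p,q}$ be the (semisimple) real Clifford algebra generated by an orthonormal basis $e_1,\dots,e_{p+q}$ with $e_i^2=\varepsilon_i$, where $\varepsilon_i=1$ for $i\le p$ and $\varepsilon_i=-1$ for $i>p$. Let $T$ be the transposition, that is, the unique anti-automorphism of the algebra $Cl_{p,q}$ with $T(e_i)=\varepsilon_i e_i$ for all $i$, and put $$G^{\varepsilon}_{p,q}=\{g\in Cl_{p,q} : T(g)g=1\}.$$ Let $r_i$ ($i\in\mathbb Z$) be the Radon–Hurwitz numbers: $r_0=0$, $r_1=1$, $r_2=r_3=2$, $r_4=r_5=r_6=r_7=3$, $r_{i+8}=r_i+4$. Put $k=q-r_{q-p}$; then $k\ge 1$, and we set $N=2^{k-1}$. Let $O(N)$ be the real orthogonal group and $Sp(N)=U_{\mathbb H}(N)$ the quaternionic unitary group. Then there are group isomorphisms $$G^{\varepsilon}_{p,q}\cong\begin{cases} O(N)\times O(N) & \text{if } p-q\equiv 1 \pmod 8,\\ Sp(N)\times Sp(N) & \text{if } p-q\equiv 5 \pmod 8.\end{cases}$$ More precisely,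 there are primitive idempotents $f\in Cl_{p,q}$ with $T(f)=f$, and the following holds for each of them. Let $\hat f$ be the grade involution of $f$, and put $S=Cl_{p,q}f$, $\hat S=Cl_{p,q}\hat f$, $\check S=S\oplus\hat S$, $\mathbb K=fCl_{p,q}f$, $\hat{\mathbb K}=\hat fCl_{p,q}\hat f$. The transposition product on $\check S$ is $$\bigl((\psi,\psi_g),(\phi,\phi_g)\bigr)\longmapsto \bigl(T(\psi)\phi,\;T(\psi_g)\phi_g\bigr)\in\mathbb K\oplus\hat{\mathbb K}.$$ 1. $G^{\varepsilon}_{p,q}$ is the set of all $g\in Cl_{p,q}$ such that left multiplication by $g$ preserves the transposition product on $\check S$. 2. Let $(\mathbb F,H)=(\mathbb R,O(N))$ if $p-q\equiv 1 \pmod 8$ and $(\mathbb F,H)=(\mathbb H,Sp(N))$ if $p-q\equiv 5 \pmod 8$. Then $\mathbb K\cong\hat{\mathbb K}\cong\mathbb F$ as real algebras, and there are right-linear isomorphisms $S\cong\mathbb F^N$ over $\mathbb K\cong\mathbb F$ and $\hat S\cong\mathbb F^N$ over $\hat{\mathbb K}\cong\mathbb F$ under which both components of the transposition product become the standard Hermitian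 form $\sum_i\overline{x_i}\,y_i$. In these coordinates left multiplication gives an isomorphism of real algebras $Cl_{p,q}\cong \mathrm{Mat}_N(\mathbb F)\times\mathrm{Mat}_N(\mathbb F)$ that carries $G^{\varepsilon}_{p,q}$ onto $H\times H$. -/

import Mathlib

open scoped Quaternion

noncomputable section

namespace CliffordTransposition

/-- The signs `ε_i` of an orthonormal basis of `ℝ^{p,q}`: `p` times `1` and `q` times `-1`. -/
def sgn (p q : ℕ) : Fin p ⊕ Fin q → ℝ := Sum.elim (fun _ => 1) (fun _ => -1)

/-- The quadratic form `Q(x) = ∑ ε_i x_i ^ 2` of signature `(p, q)`. -/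
abbrev Q (p q : ℕ) : QuadraticForm ℝ (Fin p ⊕ Fin q → ℝ) :=
  QuadraticMap.weightedSumSquares ℝ (sgn p q)

/-- The real Clifford algebra `Cl_{p,q}`. -/
abbrev Cl (p q : ℕ) : Type := CliffordAlgebra (Q p q)

theorem sgn_mul_self (p q : ℕ) (i : Fin p ⊕ Fin q) : sgn p q i * sgn p q i = 1 := by
  rcases i with i | i <;> simp [sgn]

/-- The orthogonal involution `t_ε (∑ x_i e_i) = ∑ x_i (ε_i e_i)`. -/
def tEps (p q : ℕ) : Q p q →qᵢ Q p q where
  toFun x := fun i => x i * sgn p q i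
  map_add' x y := by ext i; simp [add_mul]
  map_smul' r x := by ext i; simp [mul_assoc]
  map_app' x := by
    simp only [QuadraticMap.weightedSumSquares_apply]
    refine Finset.sum_congr rfl fun i _ => ?_
    have h := sgn_mul_self p q i
    simp only [smul_eq_mul]
    linear_combination (sgn p q i * x i * x i) * h

/-- The transposition anti-involution of `Cl_{p,q}`: the anti-automorphism that extends `t_ε`,
that is, reversion composed with the automorphism induced by `t_ε`. -/
def transp {p q : ℕ} : Cl p q →ₗ[ℝ] Cl p q :=
  CliffordAlgebra.reverse ∘ₗ (CliffordAlgebra.map (tEps p q)).toLinearMap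

theorem transp_mul {p q : ℕ} (a b : Cl p q) : transp (a * b) = transp b * transp a := by
  simp [transp, CliffordAlgebra.reverse.map_mul]

theorem transp_one {p q : ℕ} : transp (1 : Cl p q) = 1 := by
  simp [transp]

theorem transp_ι {p q : ℕ} (v : Fin p ⊕ Fin q → ℝ) :
    transp (CliffordAlgebra.ι (Q p q) v) = CliffordAlgebra.ι (Q p q) (tEps p q v) := by
  simp [transp]

theorem transp_involute {p q : ℕ} (a : Cl p q) :
    transp (CliffordAlgebra.involute a) = CliffordAlgebra.involute (transp a) := by
  have h : (CliffordAlgebra.map (tEps p q)).comp CliffordAlgebra.involute =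
      CliffordAlgebra.involute.comp (CliffordAlgebra.map (tEps p q)) := by
    ext v
    simp
  have h' := DFunLike.congr_fun h a
  simp only [AlgHom.comp_apply] at h'
  simp [transp, h', CliffordAlgebra.reverse_involute]

/-- The group `G^ε_{p,q} = {g ∈ Cl_{p,q} | T(g) g = 1}`, where `T` is the transposition. -/
def Geps (p q : ℕ) : Submonoid (Cl p q) where
  carrier := {g | transp g * g = 1}
  one_mem' := by simp [transp_one]
  mul_mem' := by
    intro a b ha hb
    have ha' : transp a * a = 1 := ha
    have hb' : transp b * b = 1 := hb
    change transp (a * b) * (a * b) = 1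
    calc transp (a * b) * (a * b) = transp b * (transp a * a) * b := by
          rw [transp_mul]; simp only [mul_assoc]
      _ = 1 := by rw [ha', mul_one, hb']

/-- A primitive idempotent of a ring: a nonzero idempotent that is not the sum of two nonzero
orthogonal idempotents. -/
def IsPrimitiveIdempotent {R : Type*} [Ring R] (f : R) : Prop :=
  IsIdempotentElem f ∧ f ≠ 0 ∧
    ∀ a b : R, IsIdempotentElem a → IsIdempotentElem b → a * b = 0 → b * a = 0 → f = a + b →
      a = 0 ∨ b = 0

theorem IsPrimitiveIdempotent.map {R : Type*} [Ring R] {f : R} (hf : IsPrimitiveIdempotent f)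
    (e : R ≃+* R) : IsPrimitiveIdempotent (e f) := by
  obtain ⟨h1, h2, h3⟩ := hf
  refine ⟨h1.map e, by simpa using h2, fun a b ha hb hab hba h => ?_⟩
  have := h3 (e.symm a) (e.symm b) (ha.map e.symm) (hb.map e.symm)
    (by rw [← map_mul, hab, map_zero]) (by rw [← map_mul, hba, map_zero])
    (by rw [← map_add, ← h, e.symm_apply_apply])
  simpa using this

/-- A primitive idempotent `f` of `Cl_{p,q}` that is fixed by the transposition. Among these are
all primitive idempotents of the form `∏ (1 ± m_j) / 2` with pairwise commuting basis monomials
`m_j` such that `m_j ^ 2 = 1`, because the transposition sends a basis monomial to its inverse. -/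
structure SpinorIdempotent (p q : ℕ) where
  f : Cl p q
  primitive : IsPrimitiveIdempotent f
  transp_f : transp f = f

namespace SpinorIdempotent

variable {p q : ℕ}

/-- The grade involution `f̂` of `f`. -/
def hat (F : SpinorIdempotent p q) : SpinorIdempotent p q where
  f := CliffordAlgebra.involute F.f
  primitive := F.primitive.map (CliffordAlgebra.involuteEquiv (Q := Q p q)).toRingEquiv
  transp_f := by rw [transp_involute, F.transp_f]

theorem idem (F : SpinorIdempotent p q) : IsIdempotentElem F.f := F.primitive.1

/-- The minimal left ideal `S = Cl_{p,q} f`; then `F.hat.S` is `Ŝ = Cl_{p,q} f̂`. -/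
abbrev S (F : SpinorIdempotent p q) : Submodule (Cl p q) (Cl p q) := Ideal.span {F.f}

/-- The ring `𝕂 = f Cl_{p,q} f`, with unit `f`; then `F.hat.K` is `𝕂̂ = f̂ Cl_{p,q} f̂`. -/
abbrev K (F : SpinorIdempotent p q) : Type := F.idem.Corner

theorem mul_f (F : SpinorIdempotent p q) (ψ : F.S) : (ψ : Cl p q) * F.f = ψ := by
  obtain ⟨a, ha⟩ := Ideal.mem_span_singleton'.1 ψ.2
  rw [← ha, mul_assoc, F.idem.eq]

/-- The product `(ψ, φ) ↦ T(ψ) φ` on `S`, with values in `𝕂`. -/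
def prod (F : SpinorIdempotent p q) (ψ φ : F.S) : F.K :=
  ⟨transp (ψ : Cl p q) * (φ : Cl p q), transp (ψ : Cl p q) * (φ : Cl p q), by
    conv_rhs => rw [← F.mul_f ψ, ← F.mul_f φ, transp_mul, F.transp_f]
    simp only [mul_assoc]⟩

/-- Right multiplication `S × 𝕂 → S`. -/
def rsmul (F : SpinorIdempotent p q) (ψ : F.S) (a : F.K) : F.S :=
  ⟨(ψ : Cl p q) * a.1, by
    obtain ⟨b, hb⟩ := a.2
    have hb' : F.f * b * F.f = a.1 := hb
    refine Ideal.mem_span_singleton'.2 ⟨(ψ : Cl p q) * (F.f * b), ?_⟩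
    rw [← hb', mul_assoc]⟩

/-- The transposition scalar product on `Š = S ⊕ Ŝ`, with values in `𝕂 ⊕ 𝕂̂`:
`((ψ, ψ_g), (φ, φ_g)) ↦ (T(ψ) φ, T(ψ_g) φ_g)`. -/
def spinorProd (F : SpinorIdempotent p q) (ψ φ : F.S × F.hat.S) : F.K × F.hat.K :=
  (F.prod ψ.1 φ.1, F.hat.prod ψ.2 φ.2)

/-- Coordinates on `S` in which the spinor representation is the matrix representation `ρ`:
an isomorphism of real algebras `κ : 𝕂 ≃ 𝔽` and a right-linear isomorphism `σ : S ≃ 𝔽 ^ N` along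
`κ`, such that `Cl_{p,q}` acts on `S` through `ρ` and the transposition product is the
standard Hermitian form `∑ star (x_i) y_i`. -/
structure Coordinates (F : SpinorIdempotent p q) {𝔽 : Type} [Ring 𝔽] [StarRing 𝔽] [Algebra ℝ 𝔽]
    {N : ℕ} (ρ : Cl p q →ₐ[ℝ] Matrix (Fin N) (Fin N) 𝔽) where
  κ : F.K ≃+* 𝔽
  κ_smul : ∀ (r : ℝ) (a b : F.K), b.1 = r • a.1 → κ b = r • κ a
  σ : F.S ≃ₗ[ℝ] (Fin N → 𝔽)
  σ_rsmul : ∀ (ψ : F.S) (a : F.K) (i : Fin N), σ (F.rsmul ψ a) i = σ ψ i * κ a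
  σ_smul : ∀ (u : Cl p q) (ψ : F.S), σ (u • ψ) = Matrix.mulVec (ρ u) (σ ψ)
  κ_prod : ∀ ψ φ : F.S, κ (F.prod ψ φ) = dotProduct (star (σ ψ)) (σ φ)

end SpinorIdempotent

/-- The Radon-Hurwitz numbers: `r_0 = 0`, `r_1 = 1`, `r_2 = r_3 = 2`, `r_4 = ⋯ = r_7 = 3` and
`r_{i+8} = r_i + 4` for all integers `i`. -/
def radonHurwitz (i : ℤ) : ℤ :=
  4 * (i / 8) +
    (if i % 8 = 0 then 0 else if i % 8 = 1 then 1 else if i % 8 = 2 ∨ i % 8 = 3 then 2 else 3)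

/-- The number `k = q - r_{q-p}`. -/
def kNum (p q : ℕ) : ℤ := q - radonHurwitz ((q : ℤ) - p)

/-- The number `N = 2 ^ (k - 1)`; in the semisimple case `k ≥ 1`. -/
def NNum (p q : ℕ) : ℕ := 2 ^ (kNum p q - 1).toNat

/-- The compact symplectic group `Sp(N)`, the quaternionic unitary group. -/
abbrev Sp (N : ℕ) : Submonoid (Matrix (Fin N) (Fin N) ℍ[ℝ]) :=
  unitary (Matrix (Fin N) (Fin N) ℍ[ℝ])

/-- The orthogonal group `O(N)`. -/
abbrev O (N : ℕ) : Submonoid (Matrix (Fin N) (Fin N) ℝ) := Matrix.orthogonalGroup (Fin N) ℝ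

/-- Under the spinor representation on `S ⊕ Ŝ`, written in suitable coordinates, `Cl_{p,q}` is
the algebra of pairs of `N × N` matrices over `𝔽` and `G^ε_{p,q}` is the group `H × H`. -/
def SpinorGroupIs {p q : ℕ} (F : SpinorIdempotent p q) (𝔽 : Type) [Ring 𝔽] [StarRing 𝔽]
    [Algebra ℝ 𝔽] {N : ℕ} (H : Submonoid (Matrix (Fin N) (Fin N) 𝔽)) : Prop :=
  ∃ Φ : Cl p q ≃ₐ[ℝ] Matrix (Fin N) (Fin N) 𝔽 × Matrix (Fin N) (Fin N) 𝔽,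
    Nonempty (F.Coordinates ((AlgHom.fst ℝ _ _).comp Φ.toAlgHom)) ∧
    Nonempty (F.hat.Coordinates ((AlgHom.snd ℝ _ _).comp Φ.toAlgHom)) ∧
    (Geps p q).map Φ = H.prod H

end CliffordTransposition

end

/-!
The algebra `Cl_{p,q}` with the transposition `T` is isomorphic, as a star algebra, to
`Mat_N(𝔽) × Mat_N(𝔽)` with the conjugate transpose, where `𝔽` is `ℝ` or `ℍ`; the grade involution
exchanges the two factors. All claims are read off from such a model.

*The model.* In a star algebra `A`, consider anticommuting generators `e i` with `e i ^ 2 = ε_i` and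
`star (e i) = ε_i e i` (`IsCliffordSystem`). They induce a surjection `Cl_{p,q} → A` that carries
`T` to `star`, and it is bijective if `A` has dimension `2 ^ (p + q)`, the dimension of the Clifford
algebra. Such generators exist in `ℝ × ℝ` for signature `(1, 0)` and in `ℍ × ℍ` for `(0, 3)`.
Passing to `2 × 2` matrices raises `(p, q)` to `(p + 1, q + 1)` (`IsCliffordSystem.double`),
multiplying all other generators by one of square `1` turns `(p + 1, q)` into `(q + 1, p)`
(`IsCliffordSystem.twist`), and multiplying four generators of square `1` by their product turns
`(p + 4, q)` into `(p, q + 4)` (`IsCliffordSystem.flipFour`). These moves reach every signature with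
`p - q ≡ 1` modulo `4` (`HasMatrixSystem.induction`). Along the way the central element `(1, -1)`
stays a sum of products of an odd number of generators, so the grade involution changes its sign.

*Spinors.* In the model a primitive idempotent `f` with `T(f) = f` is the orthogonal projection
`v v*` onto a unit vector `v` of one of the two factors
(`IsPrimitiveIdempotent.exists_eq_vecMulVec`), and `f̂` lies in the other one
(`IsSpinorModel.hat_fst_eq_zero`). Then `ψ ↦ ψ v` identifies `S` with `𝔽 ^ N`, `a ↦ v* a v`
identifies `𝕂` with `𝔽`, and `T(ψ) φ` becomes `(ψ v)* (φ v)`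
(`SpinorIdempotent.nonempty_coordinates`). The condition `T(g) g = 1` says that both matrices of `g`
are unitary.
-/

open scoped Quaternion Matrix

noncomputable section

namespace CliffordTransposition

open Matrix (vecMulVec)

/-! ### Clifford systems and the moves between signatures -/

theorem adjoin_eq_top_of_mem {A κ κ' : Type*} [Ring A] [Algebra ℝ A] {e : κ → A} {e' : κ' → A}
    (h : Algebra.adjoin ℝ (Set.range e) = ⊤)
    (hm : ∀ i, e i ∈ Algebra.adjoin ℝ (Set.range e')) :
    Algebra.adjoin ℝ (Set.range e') = ⊤ := by
  rw [eq_top_iff, ← h]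
  exact Algebra.adjoin_le (by rintro _ ⟨i, rfl⟩; exact hm i)

/-- Conjugation by `u` with `u * u = 1`. -/
def conjHom {A : Type*} [Ring A] [Algebra ℝ A] (u : A) (hu : u * u = 1) : A →ₐ[ℝ] A :=
  AlgHom.ofLinearMap (LinearMap.mulLeft ℝ u ∘ₗ LinearMap.mulRight ℝ u)
    (by simp [hu]) (fun x y => by
      simp only [LinearMap.comp_apply, LinearMap.mulRight_apply, LinearMap.mulLeft_apply]
      calc u * (x * y * u) = u * x * 1 * (y * u) := by simp only [mul_one, mul_assoc]
        _ = _ := by rw [← hu]; simp only [mul_assoc])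

theorem conjHom_apply {A : Type*} [Ring A] [Algebra ℝ A] (u : A) (hu : u * u = 1) (x : A) :
    conjHom u hu x = u * (x * u) := rfl

/-- The product `η` of four anticommuting elements of square `1` has square `1`, equals the product
in reverse order and anticommutes with each of the four; the product of the elements `a η`, `b η`,
`c η`, `d η` is `η` again. -/
theorem four_relations {A : Type*} [Ring A] {a b c d : A}
    (haa : a * a = 1) (hbb : b * b = 1) (hcc : c * c = 1)
    (hdd : d * d = 1) (hba : b * a = -(a * b)) (hca : c * a = -(a * c)) (hda : d * a = -(a * d))
    (hcb : c * b = -(b * c)) (hdb : d * b = -(b * d)) (hdc : d * c = -(c * d)) :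
    (a * b * c * d) * (a * b * c * d) = 1 ∧ d * (c * (b * a)) = a * b * c * d ∧
    (a * b * c * d) * a = -(a * (a * b * c * d)) ∧ (a * b * c * d) * b = -(b * (a * b * c * d)) ∧
    (a * b * c * d) * c = -(c * (a * b * c * d)) ∧ (a * b * c * d) * d = -(d * (a * b * c * d)) ∧
    (a * (a * b * c * d)) * (b * (a * b * c * d)) * (c * (a * b * c * d)) *
      (d * (a * b * c * d)) = a * b * c * d := by
  have l {x y : A} (h : y * x = -(x * y)) (z : A) : y * (x * z) = -(x * (y * z)) := by
    rw [← mul_assoc, h, neg_mul, mul_assoc]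
  have k {x : A} (h : x * x = 1) (z : A) : x * (x * z) = z := by rw [← mul_assoc, h, one_mul]
  refine ⟨?_, ?_, ?_, ?_, ?_, ?_, ?_⟩ <;>
  simp only [mul_assoc, haa, hbb, hcc, hdd, hba, hda, hcb, hdb, hdc, l hba, l hca, l hda,
    l hcb, l hdb, l hdc, k haa, k hbb, k hcc, neg_neg, mul_neg, neg_mul, mul_one]

/-- Clifford generators of a star algebra `A`: pairwise anticommuting elements `e i` that generate
`A`, with square `s i` and adjoint `s i • e i`. The field `odd` says that `A` has an endomorphism
which changes the sign of all generators and of the given element `c`; this expresses that `c` is a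
sum of products of an odd number of generators. -/
structure IsCliffordSystem {κ A : Type*} [Ring A] [StarRing A] [Algebra ℝ A]
    (s : κ → ℝ) (c : A) (e : κ → A) : Prop where
  sq : ∀ i, e i * e i = algebraMap ℝ A (s i)
  anti : ∀ i j, i ≠ j → e i * e j = -(e j * e i)
  star_e : ∀ i, star (e i) = s i • e i
  adjoin : Algebra.adjoin ℝ (Set.range e) = ⊤
  odd : ∃ α : A →ₐ[ℝ] A, (∀ i, α (e i) = -e i) ∧ α c = -c

namespace IsCliffordSystem

variable {κ A : Type*} [Ring A] [StarRing A] [Algebra ℝ A] {s : κ → ℝ} {c : A}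

theorem reindex {κ' : Type*} {e : κ → A} (h : IsCliffordSystem s c e) {f : κ' → κ}
    (hf : Function.Bijective f) {s' : κ' → ℝ} (hs : ∀ i, s' i = s (f i)) :
    IsCliffordSystem s' c (e ∘ f) where
  sq i := by rw [hs]; exact h.sq _
  anti i j hij := h.anti _ _ (hf.1.ne hij)
  star_e i := by rw [hs]; exact h.star_e _
  adjoin := by rw [hf.2.range_comp]; exact h.adjoin
  odd := by
    obtain ⟨α, h1, h2⟩ := h.odd
    exact ⟨α, fun i => h1 _, h2⟩

theorem map {B : Type*} [Ring B] [StarRing B] [Algebra ℝ B] {e : κ → A}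
    (h : IsCliffordSystem s c e) (φ : A ≃ₐ[ℝ] B) (hφ : ∀ a, φ (star a) = star (φ a)) :
    IsCliffordSystem s (φ c) (φ ∘ e) where
  sq i := by simp [← map_mul, h.sq]
  anti i j hij := by simp only [Function.comp, ← map_mul, ← map_neg, h.anti i j hij]
  star_e i := by simp [← hφ, h.star_e]
  adjoin := by
    have : Algebra.adjoin ℝ (Set.range (φ ∘ e)) =
        (Algebra.adjoin ℝ (Set.range e)).map φ.toAlgHom := by
      rw [AlgHom.map_adjoin, Set.range_comp]; rfl
    rw [this, h.adjoin, Algebra.map_top, AlgHom.range_eq_top]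
    exact φ.surjective
  odd := by
    obtain ⟨α, h1, h2⟩ := h.odd
    exact ⟨(φ.toAlgHom.comp α).comp φ.symm.toAlgHom, fun i => by simp [h1], by simp [h2]⟩

/-- If `e₀ ^ 2 = 1`, then `e₀` and the products `e i * e₀` again form a Clifford system, in which
the signs of all generators but `e₀` are reversed. -/
theorem twist {s : Option κ → ℝ} {e : Option κ → A} (h : IsCliffordSystem s c e)
    (hs : s none = 1) (hc : ∀ a, c * a = a * c) :
    IsCliffordSystem (fun o : Option κ => o.elim 1 fun i => -s (some i)) c
      (fun o : Option κ => o.elim (e none) fun i => e (some i) * e none) := by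
  have h0 : e none * e none = 1 := by simpa [hs] using h.sq none
  have h1 : ∀ i, e none * e (some i) = -(e (some i) * e none) := fun i => h.anti _ _ (by simp)
  have h2 : ∀ i j, e (some i) * e none * (e (some j) * e none) = -(e (some i) * e (some j)) := by
    intro i j
    rw [mul_assoc, ← mul_assoc (e none), h1, neg_mul, mul_assoc _ _ (e none), h0]; simp
  have hmem : ∀ o : Option κ, (o.elim (e none) fun i => e (some i) * e none) ∈
      Algebra.adjoin ℝ
        (Set.range fun o : Option κ => o.elim (e none) fun i => e (some i) * e none) :=
    fun o => Algebra.subset_adjoin ⟨o, rfl⟩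
  constructor
  · rintro (_ | i)
    · simp [h0]
    · simp [h2, h.sq]
  · rintro (_ | i) (_ | j) hij
    · simp at hij
    · simp only [Option.elim]
      rw [← mul_assoc, h1, neg_mul]
    · simp only [Option.elim]
      rw [← mul_assoc (e none), h1, neg_mul, neg_neg]
    · simp only [Option.elim, h2]
      rw [h.anti (some i) (some j) (by simpa using hij)]
  · rintro (_ | i)
    · simp [h.star_e, hs]
    · simp [h.star_e, hs, h1]
  · refine adjoin_eq_top_of_mem h.adjoin ?_
    rintro (_ | i)
    · exact hmem none
    · have := mul_mem (hmem (some i)) (hmem none)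
      simpa only [Option.elim, mul_assoc, h0, mul_one] using this
  · obtain ⟨α, ha, hac⟩ := h.odd
    -- `α` fixes `e i * e₀`, and conjugation by `e₀` restores the sign
    refine ⟨(conjHom (e none) h0).comp α, ?_, ?_⟩
    · rintro (_ | i)
      · simp [ha, conjHom_apply, h0]
      · change conjHom (e none) h0 (α (e (some i) * e none)) = _
        rw [map_mul, ha, ha, neg_mul_neg, conjHom_apply, mul_assoc (e (some i)), h0, mul_one, h1]
        rfl
    · simp only [AlgHom.comp_apply, hac, conjHom_apply]
      rw [neg_mul, hc, mul_neg, ← mul_assoc, h0, one_mul]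

/-- Multiplying four generators of square `1` by their product `η` gives four generators of
square `-1`. -/
theorem flipFour {s : κ ⊕ Fin 4 → ℝ} {e : κ ⊕ Fin 4 → A} (h : IsCliffordSystem s c e)
    (hs : ∀ i, s (Sum.inr i) = 1) :
    IsCliffordSystem (Sum.elim (fun i => s (Sum.inl i)) fun _ => -1) c
      (Sum.elim (fun i => e (Sum.inl i)) fun i => e (Sum.inr i) *
        (e (Sum.inr 0) * e (Sum.inr 1) * e (Sum.inr 2) * e (Sum.inr 3))) := by
  have hsq : ∀ i, e (Sum.inr i) * e (Sum.inr i) = 1 := fun i => by simpa [hs] using h.sq (Sum.inr i)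
  have hst : ∀ i, star (e (Sum.inr i)) = e (Sum.inr i) := fun i => by
    simpa [hs] using h.star_e (Sum.inr i)
  have han : ∀ i j, i ≠ j → e (Sum.inr i) * e (Sum.inr j) = -(e (Sum.inr j) * e (Sum.inr i)) :=
    fun i j hij => h.anti _ _ (by simpa using hij)
  obtain ⟨r1, r2, r3, r4, r5, r6, r7⟩ := four_relations (hsq 0) (hsq 1) (hsq 2) (hsq 3)
    (han 1 0 (by decide)) (han 2 0 (by decide)) (han 3 0 (by decide)) (han 2 1 (by decide))
    (han 3 1 (by decide)) (han 3 2 (by decide))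
  generalize hη : e (Sum.inr 0) * e (Sum.inr 1) * e (Sum.inr 2) * e (Sum.inr 3) = η at *
  have hηst : star η = η := by
    rw [← hη]; simp only [star_mul, hst]; rw [r2, hη]
  have hηe : ∀ i, η * e (Sum.inr i) = -(e (Sum.inr i) * η) := by
    intro i; fin_cases i <;> assumption
  have hηl : ∀ i, η * e (Sum.inl i) = e (Sum.inl i) * η := by
    intro i
    have k (j) : e (Sum.inr j) * e (Sum.inl i) = -(e (Sum.inl i) * e (Sum.inr j)) :=
      h.anti _ _ (by simp)
    have l (j) (z : A) : e (Sum.inr j) * (e (Sum.inl i) * z) =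
        -(e (Sum.inl i) * (e (Sum.inr j) * z)) := by
      rw [← mul_assoc, k, neg_mul, mul_assoc]
    rw [← hη]
    simp only [mul_assoc, k, l, mul_neg, neg_neg]
  have hee : ∀ i j, e (Sum.inr i) * η * (e (Sum.inr j) * η) = -(e (Sum.inr i) * e (Sum.inr j)) := by
    intro i j
    rw [mul_assoc, ← mul_assoc η, hηe, neg_mul, mul_assoc _ η, r1]; simp
  constructor
  · rintro (i | i)
    · exact h.sq _
    · simp [hee, hsq]
  · rintro (i | i) (j | j) hij
    · exact h.anti _ _ (by simpa using hij)
    · simp only [Sum.elim_inl, Sum.elim_inr]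
      rw [← mul_assoc, mul_assoc _ η, hηl, ← mul_assoc, h.anti (Sum.inl i) (Sum.inr j) (by simp),
        neg_mul]
    · simp only [Sum.elim_inl, Sum.elim_inr]
      rw [← mul_assoc, mul_assoc _ η, hηl, ← mul_assoc, h.anti (Sum.inr i) (Sum.inl j) (by simp),
        neg_mul]
    · simp only [Sum.elim_inr, hee]
      rw [han i j (by simpa using hij)]
  · rintro (i | i)
    · exact h.star_e _
    · simp [hηst, hst, hηe]
  · set e' : κ ⊕ Fin 4 → A := Sum.elim (fun i => e (Sum.inl i)) fun i => e (Sum.inr i) * η with he'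
    have hmem : ∀ o, e' o ∈ Algebra.adjoin ℝ (Set.range e') :=
      fun o => Algebra.subset_adjoin ⟨o, rfl⟩
    have hm : η ∈ Algebra.adjoin ℝ (Set.range e') := by
      -- `η` is the product of the four new generators
      rw [← r7]
      exact mul_mem (mul_mem (mul_mem (hmem (Sum.inr 0)) (hmem (Sum.inr 1))) (hmem (Sum.inr 2)))
        (hmem (Sum.inr 3))
    refine adjoin_eq_top_of_mem h.adjoin ?_
    rintro (i | i)
    · exact hmem (Sum.inl i)
    · have := mul_mem (hmem (Sum.inr i)) hm
      simpa only [he', Sum.elim_inr, mul_assoc, r1, mul_one] using this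
  · obtain ⟨α, ha, hac⟩ := h.odd
    refine ⟨α, ?_, hac⟩
    have : α η = η := by
      rw [← hη]; simp [ha]
    rintro (i | i)
    · exact ha _
    · simp [ha, this]

/-- The generators `e i ⊗ σ_z` together with `σ_x` and `i σ_y` form a Clifford system of the `2 × 2`
matrices over `A`. -/
theorem double {e : κ → A} (h : IsCliffordSystem s c e) :
    IsCliffordSystem (fun o : Option (Option κ) => o.elim 1 fun o => o.elim (-1) s)
      (Matrix.scalar (Fin 2) c)
      (fun o => o.elim !![0, 1; 1, 0] fun o => o.elim !![0, 1; -1, 0] fun i =>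
        !![e i, 0; 0, -e i]) := by
  constructor
  · rintro (_ | _ | i)
    · simp [Matrix.one_fin_two]
    · simp [Matrix.one_fin_two]
    · simp [h.sq, Matrix.algebraMap_eq_diagonal]
      ext a b; fin_cases a <;> fin_cases b <;> simp
  · rintro (_ | _ | i) (_ | _ | j) hij
    · simp at hij
    · simp
    · simp
    · simp
    · simp at hij
    · simp
    · simp
    · simp
    · simp [h.anti i j (by simpa using hij)]
  · rintro (_ | _ | i)
    · ext a b; fin_cases a <;> fin_cases b <;> simp [Matrix.star_apply]
    · ext a b; fin_cases a <;> fin_cases b <;> simp [Matrix.star_apply]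
    · ext a b; fin_cases a <;> fin_cases b <;> simp [Matrix.star_apply, h.star_e]
  · set e' : Option (Option κ) → Matrix (Fin 2) (Fin 2) A :=
      fun o => o.elim !![0, 1; 1, 0] fun o => o.elim !![0, 1; -1, 0] fun i =>
        !![e i, 0; 0, -e i] with he'
    set W := Algebra.adjoin ℝ (Set.range e') with hW
    have hmem : ∀ o, e' o ∈ W := fun o => Algebra.subset_adjoin ⟨o, rfl⟩
    have hx : (!![0, 1; 1, 0] : Matrix (Fin 2) (Fin 2) A) ∈ W := hmem none
    have hy : (!![0, 1; -1, 0] : Matrix (Fin 2) (Fin 2) A) ∈ W := hmem (some none)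
    have hz : (!![1, 0; 0, -1] : Matrix (Fin 2) (Fin 2) A) ∈ W := by
      have := mul_mem hy hx
      simpa using this
    have hsc : ∀ a : A, (!![a, 0; 0, a] : Matrix (Fin 2) (Fin 2) A) ∈ W := by
      have hcomap : W.comap (Matrix.scalarAlgHom (Fin 2) ℝ) = ⊤ := by
        rw [eq_top_iff, ← h.adjoin]
        refine Algebra.adjoin_le ?_
        rintro _ ⟨i, rfl⟩
        have := mul_mem (hmem (some (some i))) hz
        simp [he'] at this
        change Matrix.scalarAlgHom (Fin 2) ℝ (e i) ∈ W
        convert this using 1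
        ext a b; fin_cases a <;> fin_cases b <;> simp
      intro a
      have ha : a ∈ W.comap (Matrix.scalarAlgHom (Fin 2) ℝ) := by rw [hcomap]; trivial
      have ha' : Matrix.scalarAlgHom (Fin 2) ℝ a ∈ W := ha
      convert ha' using 1
      ext a b; fin_cases a <;> fin_cases b <;> simp
    rw [eq_top_iff]
    rintro M -
    -- `1`, `σ_z`, `σ_x`, `i σ_y` are a basis of the `2 × 2` matrices over the scalar matrices
    have key : M = (2⁻¹ : ℝ) •
        (!![M 0 0 + M 1 1, 0; 0, M 0 0 + M 1 1] + !![M 0 0 - M 1 1, 0; 0, M 0 0 - M 1 1] *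
          !![1, 0; 0, -1] + !![M 0 1 + M 1 0, 0; 0, M 0 1 + M 1 0] * !![0, 1; 1, 0] +
          !![M 0 1 - M 1 0, 0; 0, M 0 1 - M 1 0] * !![0, 1; -1, 0]) := by
      rw [eq_inv_smul_iff₀ two_ne_zero, two_smul]
      ext a b; fin_cases a <;> fin_cases b <;> simp <;> abel
    rw [key]
    exact W.smul_mem (add_mem (add_mem (add_mem (hsc _) (mul_mem (hsc _) hz)) (mul_mem (hsc _) hx))
      (mul_mem (hsc _) hy)) _
  · obtain ⟨α, ha, hac⟩ := h.odd
    -- conjugation by `σ_z` changes the signs of `σ_x` and `i σ_y` and fixes diagonal matrices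
    refine ⟨(conjHom !![1, 0; 0, -1] (by simp [Matrix.one_fin_two])).comp α.mapMatrix, ?_, ?_⟩
    · rintro (_ | _ | i)
      · ext a b; fin_cases a <;> fin_cases b <;> simp [conjHom_apply, Matrix.mul_apply]
      · ext a b; fin_cases a <;> fin_cases b <;> simp [conjHom_apply, Matrix.mul_apply]
      · ext a b; fin_cases a <;> fin_cases b <;> simp [conjHom_apply, Matrix.mul_apply, ha]
    · ext a b; fin_cases a <;> fin_cases b <;> simp [conjHom_apply, Matrix.mul_apply, hac]

end IsCliffordSystem

/-! ### Clifford systems in matrix algebras -/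

/-- Some matrix algebra over `F × F` of dimension `2 ^ (p + q)` has Clifford generators of signature
`(p, q)` for which the central element `(1, -1)` is odd. Matrices over `F × F` stand for pairs of
matrices over `F`, because this form is stable under passing to `2 × 2` matrices. -/
def HasMatrixSystem (F : Type) [Ring F] [StarRing F] [Algebra ℝ F] (p q : ℕ) : Prop :=
  ∃ m : ℕ, 2 * m ^ 2 * Module.finrank ℝ F = 2 ^ (p + q) ∧
    ∃ e : Fin p ⊕ Fin q → Matrix (Fin m) (Fin m) (F × F),
      IsCliffordSystem (sgn p q) (Matrix.scalar (Fin m) ((1, -1) : F × F)) e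

namespace HasMatrixSystem

variable {F : Type} [Ring F] [StarRing F] [Algebra ℝ F] {p q : ℕ}

theorem double (h : HasMatrixSystem F p q) : HasMatrixSystem F (p + 1) (q + 1) := by
  obtain ⟨m, hm, e, he⟩ := h
  have h1 := (he.double.map (Matrix.compAlgEquiv (Fin 2) (Fin m) (F × F) ℝ)
    fun a => (Matrix.conjTranspose_comp' a).symm).map
    (Matrix.reindexAlgEquiv ℝ (F × F) finProdFinEquiv)
    fun a => (Matrix.conjTranspose_reindex _ _ a).symm
  have h2 : Matrix.reindexAlgEquiv ℝ (F × F) finProdFinEquiv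
      (Matrix.compAlgEquiv (Fin 2) (Fin m) (F × F) ℝ
        (Matrix.scalar (Fin 2) (Matrix.scalar (Fin m) ((1, -1) : F × F)))) =
      Matrix.scalar (Fin (2 * m)) ((1, -1) : F × F) := by
    simp only [Matrix.scalar_apply, Matrix.coe_reindexAlgEquiv, Matrix.compAlgEquiv_apply,
      Matrix.comp_diagonal_diagonal, Matrix.reindex_apply, Matrix.submatrix_diagonal_equiv]
    rfl
  rw [h2] at h1
  refine ⟨2 * m, ?_, _, h1.reindex (f := Sum.elim
    (Fin.cases none fun i => some (some (Sum.inl i)))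
    (Fin.cases (some none) fun i => some (some (Sum.inr i)))) ?_ ?_⟩
  · rw [show p + 1 + (q + 1) = (p + q) + 2 by ring, pow_add, ← hm]; ring
  · refine Function.bijective_iff_has_inverse.2
      ⟨fun o => o.elim (Sum.inl 0) fun o => o.elim (Sum.inr 0) (Sum.map Fin.succ Fin.succ), ?_, ?_⟩
    · rintro (i | i) <;> refine Fin.cases ?_ (fun i => ?_) i <;> simp
    · rintro (_ | _ | i | i) <;> simp
  · rintro (i | i) <;> refine Fin.cases ?_ (fun i => ?_) i <;> simp [sgn]

theorem twist (h : HasMatrixSystem F (p + 1) q) : HasMatrixSystem F (q + 1) p := by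
  obtain ⟨m, hm, e, he⟩ := h
  have h1 := he.reindex (s' := fun o : Option (Fin p ⊕ Fin q) => o.elim 1 (sgn p q))
    (f := fun o : Option (Fin p ⊕ Fin q) => o.elim (Sum.inl 0) (Sum.map Fin.succ id))
    (Function.bijective_iff_has_inverse.2
      ⟨Sum.elim (Fin.cases none fun i => some (Sum.inl i)) fun i => some (Sum.inr i), by
        rintro (_ | i | i) <;> simp, by
        rintro (i | i)
        · refine Fin.cases ?_ (fun i => ?_) i <;> simp
        · simp⟩)
    (by rintro (_ | i | i) <;> simp [sgn])
  have h2 := h1.twist rfl fun a => (Matrix.scalar_commute _ (fun r => by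
    ext <;> simp) a).eq
  refine ⟨m, by rw [hm]; congr 1; ring, _, h2.reindex (f := Sum.elim
    (Fin.cases none fun i => some (Sum.inr i)) fun i => some (Sum.inl i)) ?_ ?_⟩
  · refine Function.bijective_iff_has_inverse.2
      ⟨fun o => o.elim (Sum.inl 0) (Sum.elim Sum.inr fun i => Sum.inl i.succ), ?_, ?_⟩
    · rintro (i | i)
      · refine Fin.cases ?_ (fun i => ?_) i <;> simp
      · simp
    · rintro (_ | i | i) <;> simp
  · rintro (i | i)
    · refine Fin.cases ?_ (fun i => ?_) i <;> simp [sgn]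
    · simp [sgn]

theorem flipFour (h : HasMatrixSystem F (p + 4) q) : HasMatrixSystem F p (q + 4) := by
  obtain ⟨m, hm, e, he⟩ := h
  have h1 := he.reindex (s' := Sum.elim (sgn p q) fun _ => 1)
    (f := ((Equiv.sumAssoc _ _ _).trans (((Equiv.refl (Fin p)).sumCongr
      (Equiv.sumComm (Fin q) (Fin 4))).trans
      ((Equiv.sumAssoc _ _ _).symm.trans (finSumFinEquiv.sumCongr (Equiv.refl _))))))
    (Equiv.bijective _) (by rintro ((i | i) | i) <;> simp [sgn])
  have h2 := h1.flipFour fun _ => rfl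
  exact ⟨m, by rw [hm]; congr 1; ring, _, h2.reindex (f :=
    (((Equiv.refl (Fin p)).sumCongr finSumFinEquiv.symm).trans (Equiv.sumAssoc _ _ _).symm))
    (Equiv.bijective _) (by
      rintro (i | i)
      · simp [sgn]
      · obtain ⟨i, rfl⟩ := finSumFinEquiv.surjective i
        rcases i with i | i <;> simp [sgn])⟩

/-- A Clifford system of `F × F` itself, seen as the algebra of `1 × 1` matrices. -/
theorem of_system {κ : Type} {s : κ → ℝ} {e : κ → F × F}
    (h : IsCliffordSystem s ((1, -1) : F × F) e) (hd : 2 * Module.finrank ℝ F = 2 ^ (p + q))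
    {f : Fin p ⊕ Fin q → κ} (hf : Function.Bijective f) (hs : ∀ i, sgn p q i = s (f i)) :
    HasMatrixSystem F p q := by
  let φ : (F × F) ≃ₐ[ℝ] Matrix (Fin 1) (Fin 1) (F × F) :=
    AlgEquiv.ofBijective (Matrix.scalarAlgHom (Fin 1) ℝ)
      ⟨fun a b h => by simpa using congrFun (congrFun h 0) 0, fun M => ⟨M 0 0, by
        ext i j <;> simp [Subsingleton.elim i 0, Subsingleton.elim j 0]⟩⟩
  refine ⟨1, by simpa using hd, _, ((h.map φ ?_).reindex hf hs)⟩
  intro a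
  exact (Matrix.diagonal_conjTranspose _).symm

/-- The generator `(1, -1)` of `ℝ × ℝ`. -/
theorem real : HasMatrixSystem ℝ 1 0 := by
  refine of_system (κ := Unit) (s := fun _ => 1) (e := fun _ => ((1, -1) : ℝ × ℝ)) ?_ (by simp)
    (f := fun _ => ()) ?_ ?_
  · constructor
    · simp
    · intro i j h; exact absurd rfl h
    · simp
    · rw [eq_top_iff]
      rintro ⟨a, b⟩ -
      have h1 : ((1, -1) : ℝ × ℝ) ∈
          Algebra.adjoin ℝ (Set.range fun _ : Unit => ((1, -1) : ℝ × ℝ)) :=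
        Algebra.subset_adjoin ⟨(), rfl⟩
      have := add_mem (Subalgebra.smul_mem _ (one_mem _) ((a + b) / 2))
        (Subalgebra.smul_mem _ h1 ((a - b) / 2))
      convert this using 1
      ext <;> simp <;> ring
    · exact ⟨(AlgHom.snd ℝ ℝ ℝ).prod (AlgHom.fst ℝ ℝ ℝ), by simp, by simp⟩
  · refine ⟨?_, fun _ => ⟨Sum.inl 0, rfl⟩⟩
    rintro (i | i) (j | j) _
    · rw [Subsingleton.elim i j]
    · exact j.elim0
    · exact i.elim0
    · exact i.elim0
  · rintro (i | i)
    · simp [sgn]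
    · exact i.elim0

/-- The generators `(i, -i)`, `(j, -j)`, `(k, -k)` of `ℍ × ℍ`. -/
theorem quaternion : HasMatrixSystem ℍ[ℝ] 0 3 := by
  obtain ⟨x, hx⟩ : ∃ x : Fin 3 → ℍ[ℝ], ∀ a, (x a).re = 0 ∧ (x a).imI = (if a = 0 then 1 else 0) ∧
      (x a).imJ = (if a = 1 then 1 else 0) ∧ (x a).imK = if a = 2 then 1 else 0 :=
    ⟨fun a => ⟨0, if a = 0 then 1 else 0, if a = 1 then 1 else 0, if a = 2 then 1 else 0⟩,
      fun a => ⟨rfl, rfl, rfl, rfl⟩⟩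
  refine of_system (κ := Fin 3) (s := fun _ => -1) (e := fun i => (x i, -x i)) ?_
    (by rw [Quaternion.finrank_eq_four]; norm_num) (f := Sum.elim Fin.elim0 id) ?_ ?_
  · constructor
    · intro i
      fin_cases i <;> ext <;> simp [hx]
    · intro i j h
      fin_cases i <;> fin_cases j <;> first | exact absurd rfl h | (ext <;> simp [hx])
    · intro i
      fin_cases i <;> ext <;> simp [hx]
    · set W := Algebra.adjoin ℝ (Set.range fun i => (x i, -x i)) with hW
      have hm : ∀ i, (x i, -x i) ∈ W := fun i => Algebra.subset_adjoin ⟨i, rfl⟩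
      have hi : (x 0, x 0) ∈ W := by
        convert mul_mem (hm 1) (hm 2) using 1
        ext <;> simp [hx]
      have hj : (x 1, x 1) ∈ W := by
        convert mul_mem (hm 2) (hm 0) using 1
        ext <;> simp [hx]
      have hk : (x 2, x 2) ∈ W := by
        convert mul_mem (hm 0) (hm 1) using 1
        ext <;> simp [hx]
      have hc : ((1, -1) : ℍ[ℝ] × ℍ[ℝ]) ∈ W := by
        convert W.neg_mem (mul_mem (hm 0) hi) using 1
        ext <;> simp [hx]
      have hd : ∀ y : ℍ[ℝ], (y, y) ∈ W := by
        intro y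
        convert add_mem (add_mem (add_mem (W.smul_mem (one_mem _) y.re) (W.smul_mem hi y.imI))
          (W.smul_mem hj y.imJ)) (W.smul_mem hk y.imK) using 1
        ext <;> simp [hx]
      rw [eq_top_iff]
      rintro ⟨a, b⟩ -
      convert W.smul_mem (add_mem (hd (a + b)) (mul_mem (hd (a - b)) hc)) (2⁻¹ : ℝ) using 1
      rw [eq_inv_smul_iff₀ two_ne_zero, two_smul]
      ext <;> simp <;> ring
    · exact ⟨(AlgHom.snd ℝ ℍ[ℝ] ℍ[ℝ]).prod (AlgHom.fst ℝ ℍ[ℝ] ℍ[ℝ]), by simp, by simp⟩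
  · refine ⟨?_, fun i => ⟨Sum.inr i, rfl⟩⟩
    rintro (i | i) (j | j) h
    · exact i.elim0
    · exact i.elim0
    · exact j.elim0
    · rw [show i = j from h]
  · rintro (i | i)
    · exact i.elim0
    · simp [sgn]

/-- Every signature with `p - q ≡ d` modulo `8`, where `d` is `1` or `5`, is obtained from `(1, 0)`
or `(0, 3)` by the three constructions. -/
theorem induction {R : ℕ → ℕ → Prop} {d : ℤ} (hd : d = 1 ∨ d = 5)
    (h10 : d = 1 → R 1 0) (h03 : d = 5 → R 0 3)
    (double : ∀ p q, R p q → R (p + 1) (q + 1)) (twist : ∀ p q, R (p + 1) q → R (q + 1) p)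
    (flip : ∀ p q, R (p + 4) q → R p (q + 4)) (p q : ℕ) (h : (p : ℤ) - q ≡ d [ZMOD 8]) : R p q := by
  induction hn : p + q using Nat.strong_induction_on generalizing p q with
  | _ n ih =>
    unfold Int.ModEq at h ih
    rcases p with _ | p
    · rcases Nat.lt_or_ge q 7 with hq | hq
      · obtain rfl : q = 3 := by omega
        exact h03 (by omega)
      · obtain ⟨q, rfl⟩ := Nat.exists_eq_add_of_le' hq
        exact flip 0 (q + 3) (double _ _ (ih _ (by omega) 3 (q + 2) (by omega) rfl))
    · rcases q with _ | q
      · rcases p with _ | p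
        · exact h10 (by omega)
        · exact twist 0 _ (double _ _ (ih _ (by omega) 0 p (by omega) rfl))
      · exact double _ _ (ih _ (by omega) p q (by omega) rfl)

end HasMatrixSystem

/-! ### The matrix model of the Clifford algebra -/

/-- The dimension of the Clifford algebra is that of the exterior algebra. -/
theorem finrank_cl (p q : ℕ) : Module.finrank ℝ (Cl p q) = 2 ^ (p + q) := by
  have : Invertible (2 : ℝ) := invertibleOfNonzero two_ne_zero
  rw [(CliffordAlgebra.equivExterior (Q p q)).finrank_eq]
  have b := ((Pi.basisFun ℝ (Fin p ⊕ Fin q)).reindex finSumFinEquiv).ExteriorAlgebra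
  rw [Module.finrank_eq_card_basis b]
  simp

instance (p q : ℕ) : Module.Finite ℝ (Cl p q) :=
  Module.finite_of_finrank_pos (by rw [finrank_cl]; positivity)

namespace IsCliffordSystem

variable {A : Type*} [Ring A] [StarRing A] [Algebra ℝ A] {p q : ℕ} {c : A}
  {e : Fin p ⊕ Fin q → A}

/-- The Clifford relation for an arbitrary vector follows from the relations between the
generators. -/
theorem linearCombination_sq (h : IsCliffordSystem (sgn p q) c e) (v : Fin p ⊕ Fin q → ℝ) :
    Fintype.linearCombination ℝ e v * Fintype.linearCombination ℝ e v =
      algebraMap ℝ A (Q p q v) := by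
  have h2 (i j) : (v i * v j) • (e i * e j) + (v i * v j) • (e j * e i) =
      if i = j then (2 : ℝ) • algebraMap ℝ A (sgn p q i * (v i * v i)) else 0 := by
    split_ifs with hij
    · subst hij
      rw [h.sq, ← two_smul ℝ, Algebra.algebraMap_eq_smul_one, Algebra.algebraMap_eq_smul_one,
        smul_smul (v i * v i), mul_comm (v i * v i)]
    · rw [h.anti i j hij, smul_neg, neg_add_cancel]
  -- twice the double sum is symmetrized, which leaves only its diagonal
  have h3 : (2 : ℝ) • (Fintype.linearCombination ℝ e v * Fintype.linearCombination ℝ e v) =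
      (2 : ℝ) • algebraMap ℝ A (Q p q v) := by
    rw [two_smul]
    simp only [Fintype.linearCombination_apply, Finset.sum_mul_sum, smul_mul_smul_comm]
    nth_rw 2 [Finset.sum_comm]
    rw [← Finset.sum_add_distrib, QuadraticMap.weightedSumSquares_apply, map_sum, Finset.smul_sum]
    refine Finset.sum_congr rfl fun i _ => ?_
    rw [← Finset.sum_add_distrib]
    calc _ = ∑ j, if i = j then (2 : ℝ) • algebraMap ℝ A (sgn p q i * (v i * v i)) else 0 :=
          Finset.sum_congr rfl fun j _ => by rw [← h2 i j, mul_comm (v j)]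
      _ = _ := by rw [Finset.sum_ite_eq, if_pos (Finset.mem_univ i)]; rfl
  exact smul_right_injective A (two_ne_zero (α := ℝ)) h3

/-- The algebra map from the Clifford algebra attached to a Clifford system. -/
def liftHom (h : IsCliffordSystem (sgn p q) c e) : Cl p q →ₐ[ℝ] A :=
  CliffordAlgebra.lift (Q p q) ⟨Fintype.linearCombination ℝ e, h.linearCombination_sq⟩

theorem liftHom_ι (h : IsCliffordSystem (sgn p q) c e) (v : Fin p ⊕ Fin q → ℝ) :
    h.liftHom (CliffordAlgebra.ι (Q p q) v) = Fintype.linearCombination ℝ e v :=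
  CliffordAlgebra.lift_ι_apply _ _ _

theorem liftHom_surjective (h : IsCliffordSystem (sgn p q) c e) :
    Function.Surjective h.liftHom := by
  rw [← AlgHom.range_eq_top, eq_top_iff, ← h.adjoin]
  refine Algebra.adjoin_le ?_
  rintro _ ⟨i, rfl⟩
  exact ⟨CliffordAlgebra.ι (Q p q) (Pi.single i 1), by
    change h.liftHom _ = _
    rw [liftHom_ι, Fintype.linearCombination_apply_single, one_smul]⟩

theorem liftHom_transp [StarModule ℝ A] (h : IsCliffordSystem (sgn p q) c e) (u : Cl p q) :
    h.liftHom (transp u) = star (h.liftHom u) := by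
  induction u using CliffordAlgebra.induction with
  | algebraMap r =>
    rw [Algebra.algebraMap_eq_smul_one, map_smul, transp_one, map_smul, map_one, star_smul,
      star_one, star_trivial]
  | ι v =>
    rw [transp_ι, liftHom_ι, liftHom_ι, Fintype.linearCombination_apply,
      Fintype.linearCombination_apply, star_sum]
    refine Finset.sum_congr rfl fun i _ => ?_
    rw [star_smul, h.star_e, star_trivial, smul_smul]
    rfl
  | mul a b ha hb => rw [transp_mul, map_mul, ha, hb, map_mul, star_mul]
  | add a b ha hb => rw [map_add, map_add, ha, hb, map_add, star_add]

theorem liftHom_involute (h : IsCliffordSystem (sgn p q) c e) {α : A →ₐ[ℝ] A}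
    (hα : ∀ i, α (e i) = -e i) (u : Cl p q) :
    h.liftHom (CliffordAlgebra.involute u) = α (h.liftHom u) := by
  have : h.liftHom.comp CliffordAlgebra.involute = α.comp h.liftHom := by
    ext v
    simp only [LinearMap.comp_apply, AlgHom.toLinearMap_apply, AlgHom.comp_apply,
      CliffordAlgebra.involute_ι, map_neg, liftHom_ι, Fintype.linearCombination_apply, map_sum,
      map_smul, hα, smul_neg, Finset.sum_neg_distrib]
  exact DFunLike.congr_fun this u

end IsCliffordSystem

/-- A matrix model of the Clifford algebra: an isomorphism onto pairs of `N × N` matrices over `F`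
that turns the transposition into the conjugate transpose, and for which the central element
`(1, -1)` is odd, so that the grade involution exchanges the two matrix factors. -/
structure IsSpinorModel {p q N : ℕ} {F : Type} [Ring F] [StarRing F] [Algebra ℝ F]
    (Φ : Cl p q ≃ₐ[ℝ] Matrix (Fin N) (Fin N) F × Matrix (Fin N) (Fin N) F) : Prop where
  map_transp : ∀ u, Φ (transp u) = star (Φ u)
  odd : ∃ c, Φ c = (1, -1) ∧ CliffordAlgebra.involute c = -c

/-- Matrices over a product of two rings are pairs of matrices. -/
def matrixProdEquiv (N : ℕ) (F : Type) [Ring F] [Algebra ℝ F] :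
    Matrix (Fin N) (Fin N) (F × F) ≃ₐ[ℝ] Matrix (Fin N) (Fin N) F × Matrix (Fin N) (Fin N) F :=
  AlgEquiv.ofBijective ((AlgHom.fst ℝ F F).mapMatrix.prod (AlgHom.snd ℝ F F).mapMatrix)
    ⟨fun a b hab => by
      ext i j
      · exact congrFun (congrFun (congrArg Prod.fst hab) i) j
      · exact congrFun (congrFun (congrArg Prod.snd hab) i) j,
    fun x => ⟨fun i j => (x.1 i j, x.2 i j), rfl⟩⟩

/-- The dimension hypothesis on `N` identifies the size of the matrices of the system, and it makes
the surjection from the Clifford algebra bijective. -/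
theorem HasMatrixSystem.exists_model {p q N : ℕ} {F : Type} [Ring F] [StarRing F] [Algebra ℝ F]
    [StarModule ℝ F] [Module.Finite ℝ F] (h : HasMatrixSystem F p q)
    (hN : 2 * N ^ 2 * Module.finrank ℝ F = 2 ^ (p + q)) :
    ∃ Φ : Cl p q ≃ₐ[ℝ] Matrix (Fin N) (Fin N) F × Matrix (Fin N) (Fin N) F, IsSpinorModel Φ := by
  obtain ⟨m, hm, e, he⟩ := h
  have hF : Module.finrank ℝ F ≠ 0 := by
    intro h0; rw [h0, mul_zero] at hN; exact absurd hN.symm (by positivity)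
  obtain rfl : m = N := by
    rw [← hm, Nat.mul_left_inj hF, Nat.mul_right_inj two_ne_zero] at hN
    exact (Nat.pow_left_injective two_ne_zero hN).symm
  have hfin : Module.finrank ℝ (Cl p q) =
      Module.finrank ℝ (Matrix (Fin m) (Fin m) (F × F)) := by
    rw [finrank_cl, ← hm, Module.finrank_matrix, Module.finrank_prod]
    simp; ring
  have hbij : Function.Bijective he.liftHom :=
    ⟨(LinearMap.injective_iff_surjective_of_finrank_eq_finrank (f := he.liftHom.toLinearMap) hfin).2
      he.liftHom_surjective, he.liftHom_surjective⟩
  refine ⟨(AlgEquiv.ofBijective he.liftHom hbij).trans (matrixProdEquiv m F), ?_, ?_⟩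
  · intro u
    change matrixProdEquiv m F (he.liftHom _) = star (matrixProdEquiv m F (he.liftHom _))
    rw [he.liftHom_transp]
    rfl
  · obtain ⟨c, hc⟩ := hbij.2 (Matrix.scalar (Fin m) ((1, -1) : F × F))
    refine ⟨c, ?_, hbij.1 ?_⟩
    · change matrixProdEquiv m F (he.liftHom c) = _
      rw [hc]
      change ((Matrix.scalar _ _).map _, (Matrix.scalar _ _).map _) = _
      ext i j <;> by_cases hij : i = j <;> simp [hij, Matrix.one_apply]
    · obtain ⟨α, hα, hαc⟩ := he.odd
      rw [he.liftHom_involute hα, hc, hαc, map_neg, hc]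

/-! ### Primitive idempotents and coordinates on spinors -/

theorem IsPrimitiveIdempotent.map_equiv {R R' : Type*} [Ring R] [Ring R'] {f : R}
    (hf : IsPrimitiveIdempotent f) (e : R ≃+* R') : IsPrimitiveIdempotent (e f) := by
  obtain ⟨h1, h2, h3⟩ := hf
  refine ⟨h1.map e, by simpa using h2, fun a b ha hb hab hba h => ?_⟩
  have := h3 (e.symm a) (e.symm b) (ha.map e.symm) (hb.map e.symm)
    (by rw [← map_mul, hab, map_zero]) (by rw [← map_mul, hba, map_zero])
    (by rw [← map_add, ← h, e.symm_apply_apply])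
  simpa using this

theorem IsPrimitiveIdempotent.fst_or_snd {R R' : Type*} [Ring R] [Ring R'] {f : R × R'}
    (hf : IsPrimitiveIdempotent f) :
    (IsPrimitiveIdempotent f.1 ∧ f.2 = 0) ∨ (f.1 = 0 ∧ IsPrimitiveIdempotent f.2) := by
  obtain ⟨h1, h2, h3⟩ := hf
  have i1 : IsIdempotentElem f.1 := congrArg Prod.fst h1.eq
  have i2 : IsIdempotentElem f.2 := congrArg Prod.snd h1.eq
  rcases h3 (f.1, 0) (0, f.2) (Prod.ext i1.eq (by simp)) (Prod.ext (by simp) i2.eq)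
    (by simp) (by simp) (by simp) with h | h
  · have hf1 : f.1 = 0 := congrArg Prod.fst h
    refine Or.inr ⟨hf1, i2, fun h0 => h2 (Prod.ext hf1 h0), fun a b ha hb hab hba hs => ?_⟩
    have := h3 (0, a) (0, b) (Prod.ext (by simp) ha.eq) (Prod.ext (by simp) hb.eq)
      (by simp [hab]) (by simp [hba]) (Prod.ext (by simp [hf1]) (by simp [hs]))
    simpa [Prod.ext_iff] using this
  · have hf2 : f.2 = 0 := congrArg Prod.snd h
    refine Or.inl ⟨⟨i1, fun h0 => h2 (Prod.ext h0 hf2), fun a b ha hb hab hba hs => ?_⟩, hf2⟩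
    have := h3 (a, 0) (b, 0) (Prod.ext ha.eq (by simp)) (Prod.ext hb.eq (by simp))
      (by simp [hab]) (by simp [hba]) (Prod.ext (by simp [hs]) (by simp [hf2]))
    simpa [Prod.ext_iff] using this

theorem IsPrimitiveIdempotent.prod_zero {R R' : Type*} [Ring R] [Ring R'] {a : R}
    (ha : IsPrimitiveIdempotent a) : IsPrimitiveIdempotent ((a, 0) : R × R') := by
  obtain ⟨h1, h2, h3⟩ := ha
  refine ⟨Prod.ext h1.eq (by simp), fun h => h2 (congrArg Prod.fst h),
    fun x y hx hy hxy hyx hs => ?_⟩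
  have s2 : x.2 + y.2 = 0 := (congrArg Prod.snd hs).symm
  have m2 : x.2 * y.2 = 0 := congrArg Prod.snd hxy
  have hx2 : x.2 = 0 := by
    have : x.2 * x.2 = x.2 := congrArg Prod.snd hx.eq
    calc x.2 = x.2 * x.2 + x.2 * y.2 := by rw [this, m2, add_zero]
      _ = 0 := by rw [← mul_add, s2, mul_zero]
  have hy2 : y.2 = 0 := by simpa [hx2] using s2
  rcases h3 x.1 y.1 (congrArg Prod.fst hx.eq) (congrArg Prod.fst hy.eq) (congrArg Prod.fst hxy)
    (congrArg Prod.fst hyx) (congrArg Prod.fst hs) with h | h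
  · exact Or.inl (Prod.ext h hx2)
  · exact Or.inr (Prod.ext h hy2)

section RankOne

variable {F : Type} [Ring F] [StarRing F] {N : ℕ} {v : Fin N → F}

theorem star_vecMulVec_self_star (v : Fin N → F) :
    star (vecMulVec v (star v)) = vecMulVec v (star v) := by
  rw [Matrix.star_eq_conjTranspose, Matrix.conjTranspose_vecMulVec, star_star]

theorem vecMulVec_self_star_mulVec (v x : Fin N → F) (i : Fin N) :
    (vecMulVec v (star v) *ᵥ x) i = v i * (star v ⬝ᵥ x) := by
  rw [Matrix.vecMulVec_mulVec]; rfl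

theorem vecMulVec_self_star_mulVec_self (hv : star v ⬝ᵥ v = 1) :
    vecMulVec v (star v) *ᵥ v = v := by
  ext i; rw [vecMulVec_self_star_mulVec, hv, mul_one]

theorem isIdempotentElem_vecMulVec (hv : star v ⬝ᵥ v = 1) :
    IsIdempotentElem (vecMulVec v (star v)) := by
  rw [IsIdempotentElem, Matrix.mul_vecMulVec, vecMulVec_self_star_mulVec_self hv]

theorem vecMulVec_ne_zero_of_unit [Nontrivial F] (hv : star v ⬝ᵥ v = 1) :
    vecMulVec v (star v) ≠ 0 := by
  intro h
  have h0 : v = 0 := by rw [← vecMulVec_self_star_mulVec_self hv, h, Matrix.zero_mulVec]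
  rw [h0] at hv
  simp at hv

/-- The projection onto a unit vector is primitive: a summand `a` in an orthogonal decomposition is
determined by the scalar `v* a v`, which is idempotent in the domain `F`. -/
theorem isPrimitiveIdempotent_vecMulVec [IsDomain F] (hv : star v ⬝ᵥ v = 1) :
    IsPrimitiveIdempotent (vecMulVec v (star v)) := by
  refine ⟨isIdempotentElem_vecMulVec hv, vecMulVec_ne_zero_of_unit hv,
    fun a b ha hb hab hba hs => ?_⟩
  have haP : a * vecMulVec v (star v) = a := by rw [hs, mul_add, ha.eq, hab, add_zero]
  have hPa : vecMulVec v (star v) * a = a := by rw [hs, add_mul, ha.eq, hba, add_zero]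
  rw [Matrix.mul_vecMulVec] at haP
  have hav : ∀ i, (a *ᵥ v) i = v i * (star v ⬝ᵥ (a *ᵥ v)) := by
    intro i
    rw [← vecMulVec_self_star_mulVec, Matrix.mulVec_mulVec, hPa]
  set c := star v ⬝ᵥ (a *ᵥ v) with hc
  have hcc : c * c = c := by
    have h1 : a *ᵥ (a *ᵥ v) = a *ᵥ v := by rw [Matrix.mulVec_mulVec, ha.eq]
    have h2 : ∀ i, (a *ᵥ v) i * c = (a *ᵥ v) i := by
      intro i
      conv_rhs => rw [← h1]
      simp only [Matrix.mulVec, dotProduct, Finset.sum_mul, mul_assoc]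
      refine Finset.sum_congr rfl fun j _ => ?_
      rw [← hav j]; rfl
    calc c * c = ∑ i, star v i * ((a *ᵥ v) i * c) := by
          rw [hc]; simp only [dotProduct, Finset.sum_mul, mul_assoc]
      _ = c := by simp only [h2]; rfl
  rcases (mul_eq_zero.1 (show c * (c - 1) = 0 by rw [mul_sub, hcc, mul_one, sub_self])) with h | h
  · left
    have : a *ᵥ v = 0 := by ext i; rw [hav, h, mul_zero]; rfl
    rw [← haP, this, Matrix.zero_vecMulVec]
  · right
    have : a *ᵥ v = v := by ext i; rw [hav, sub_eq_zero.1 h, mul_one]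
    rw [this] at haP
    rw [haP] at hs
    simpa using hs

end RankOne

/-- The elements `star x * x` are nonnegative real scalars. In a domain they then vanish only for
`x = 0`, and nonzero vectors of `F ^ N` can be normalized by a real factor. -/
def IsPositiveStar (F : Type) [Ring F] [StarRing F] [Algebra ℝ F] : Prop :=
  ∀ x : F, ∃ r : ℝ, 0 ≤ r ∧ star x * x = algebraMap ℝ F r

section Positive

variable {F : Type} [Ring F] [IsDomain F] [StarRing F] [Algebra ℝ F] [StarModule ℝ F] {N : ℕ}

theorem exists_smul_unit (hF : IsPositiveStar F) {w : Fin N → F} (hw : w ≠ 0) :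
    ∃ t : ℝ, star (t • w) ⬝ᵥ (t • w) = 1 := by
  choose r hr0 hr using hF
  have hsum : star w ⬝ᵥ w = algebraMap ℝ F (∑ i, r (w i)) := by
    rw [map_sum]; exact Finset.sum_congr rfl fun i _ => hr (w i)
  have hpos : 0 < ∑ i, r (w i) := by
    obtain ⟨i, hi⟩ := Function.ne_iff.1 hw
    refine Finset.sum_pos' (fun i _ => hr0 _) ⟨i, Finset.mem_univ i, (hr0 _).lt_of_ne ?_⟩
    intro h
    have := hr (w i)
    rw [← h, map_zero] at this
    rcases mul_eq_zero.1 this with h | h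
    · exact hi (star_eq_zero.1 h)
    · exact hi h
  refine ⟨(√(∑ i, r (w i)))⁻¹, ?_⟩
  rw [star_smul, star_trivial, smul_dotProduct, dotProduct_smul, hsum, smul_smul,
    Algebra.algebraMap_eq_smul_one, smul_smul, ← mul_inv, Real.mul_self_sqrt hpos.le,
    inv_mul_cancel₀ hpos.ne', one_smul]

/-- A primitive Hermitian idempotent matrix is the projection onto a unit vector: it splits off the
projection onto any unit vector in its image. -/
theorem IsPrimitiveIdempotent.exists_eq_vecMulVec (hF : IsPositiveStar F)
    {a : Matrix (Fin N) (Fin N) F} (ha : IsPrimitiveIdempotent a) (hs : star a = a) :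
    ∃ v : Fin N → F, star v ⬝ᵥ v = 1 ∧ a = vecMulVec v (star v) := by
  obtain ⟨h1, h2, h3⟩ := ha
  obtain ⟨x, hx⟩ : ∃ x, a *ᵥ x ≠ 0 := by
    by_contra! h
    exact h2 (Matrix.ext_of_mulVec_single fun i => by rw [h, Matrix.zero_mulVec])
  obtain ⟨t, ht⟩ := exists_smul_unit hF hx
  set v := t • (a *ᵥ x) with hv
  have hav : a *ᵥ v = v := by rw [hv, Matrix.mulVec_smul, Matrix.mulVec_mulVec, h1.eq]
  have haP : a * vecMulVec v (star v) = vecMulVec v (star v) := by rw [Matrix.mul_vecMulVec, hav]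
  have hPa : vecMulVec v (star v) * a = vecMulVec v (star v) := by
    have := congrArg star haP
    rwa [star_mul, star_vecMulVec_self_star, hs] at this
  have hP := isIdempotentElem_vecMulVec ht
  refine ⟨v, ht, ?_⟩
  rcases h3 (vecMulVec v (star v)) (a - vecMulVec v (star v)) hP
    (by rw [IsIdempotentElem, mul_sub, sub_mul, sub_mul, h1.eq, haP, hPa, hP.eq]; abel)
    (by rw [mul_sub, hPa, hP.eq, sub_self]) (by rw [sub_mul, haP, hP.eq, sub_self])
    (by abel) with h | h
  · exact absurd h (vecMulVec_ne_zero_of_unit ht)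
  · exact sub_eq_zero.1 h

end Positive

namespace SpinorIdempotent

variable {p q N : ℕ} {F : Type} [Ring F] [StarRing F] [Algebra ℝ F]

/-- If `ρ` maps `f` to the projection onto the unit vector `v`, the coordinates of `ψ ∈ S` are the
entries of `ρ(ψ) v`, and `a ∈ 𝕂` corresponds to the scalar `v* ρ(a) v`. -/
theorem nonempty_coordinates (G : SpinorIdempotent p q)
    (ρ : Cl p q →ₐ[ℝ] Matrix (Fin N) (Fin N) F) (hT : ∀ u, ρ (transp u) = star (ρ u))
    (hsurj : Function.Surjective ρ) (hinj : ∀ u, u * G.f = u → ρ u = 0 → u = 0)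
    {v : Fin N → F} (hv : star v ⬝ᵥ v = 1) (hf : ρ G.f = vecMulVec v (star v)) :
    Nonempty (G.Coordinates ρ) := by
  have hfv : ρ G.f *ᵥ v = v := by rw [hf, vecMulVec_self_star_mulVec_self hv]
  -- an element of `Cl f` is determined by where it sends `v`
  have hdet : ∀ u, u * G.f = u → ρ u *ᵥ v = 0 → u = 0 := fun u hu h => hinj u hu (by
    rw [← hu, map_mul, hf, Matrix.mul_vecMulVec, h, Matrix.zero_vecMulVec])
  have hK : ∀ a : G.K, G.f * a.1 = a.1 ∧ a.1 * G.f = a.1 :=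
    fun a => (Subsemigroup.mem_corner_iff G.idem).1 a.2
  have hKv : ∀ (a : G.K) (i : Fin N), (ρ a.1 *ᵥ v) i = v i * (star v ⬝ᵥ (ρ a.1 *ᵥ v)) := by
    intro a i
    rw [← vecMulVec_self_star_mulVec, ← hf, Matrix.mulVec_mulVec, ← map_mul, (hK a).1]
  -- right multiplication by `a ∈ 𝕂` becomes right multiplication of vectors by a scalar
  have hmulK : ∀ (X : Matrix (Fin N) (Fin N) F) (a : G.K) (i : Fin N),
      (X *ᵥ (ρ a.1 *ᵥ v)) i = (X *ᵥ v) i * (star v ⬝ᵥ (ρ a.1 *ᵥ v)) := by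
    intro X a i
    change ∑ j, X i j * (ρ a.1 *ᵥ v) j = (∑ j, X i j * v j) * _
    rw [Finset.sum_mul]
    exact Finset.sum_congr rfl fun j _ => by rw [hKv, mul_assoc]
  let κ₀ : G.K →+* F :=
    { toFun a := star v ⬝ᵥ (ρ a.1 *ᵥ v)
      map_one' := by
        change star v ⬝ᵥ (ρ G.f *ᵥ v) = 1
        rw [hfv, hv]
      map_mul' a b := by
        change star v ⬝ᵥ (ρ (a.1 * b.1) *ᵥ v) = _
        rw [map_mul, ← Matrix.mulVec_mulVec]
        change ∑ i, star v i * _ = (∑ i, star v i * _) * _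
        rw [Finset.sum_mul]
        exact Finset.sum_congr rfl fun j _ => by rw [hmulK, mul_assoc]
      map_zero' := by
        change star v ⬝ᵥ (ρ 0 *ᵥ v) = 0
        rw [map_zero, Matrix.zero_mulVec, dotProduct_zero]
      map_add' a b := by
        change star v ⬝ᵥ (ρ (a.1 + b.1) *ᵥ v) = _
        rw [map_add, Matrix.add_mulVec, dotProduct_add] }
  have hκ : Function.Bijective κ₀ := by
    constructor
    · rw [injective_iff_map_eq_zero]
      intro a ha
      refine Subtype.ext (hdet a.1 (hK a).2 ?_)
      ext i
      rw [hKv]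
      change v i * κ₀ a = 0
      rw [ha, mul_zero]
    · intro c
      obtain ⟨u, hu⟩ := hsurj (vecMulVec (fun i => v i * c) (star v))
      refine ⟨⟨G.f * u * G.f, u, rfl⟩, ?_⟩
      change star v ⬝ᵥ (ρ (G.f * u * G.f) *ᵥ v) = c
      rw [map_mul, ← Matrix.mulVec_mulVec, hfv, map_mul, hu, ← Matrix.mulVec_mulVec,
        Matrix.vecMulVec_mulVec, hv, MulOpposite.op_one, one_smul]
      have hvc : star v ⬝ᵥ (fun i => v i * c) = c := by
        calc star v ⬝ᵥ (fun i => v i * c) = (star v ⬝ᵥ v) * c := by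
              simp only [dotProduct, Finset.sum_mul, mul_assoc]
          _ = c := by rw [hv, one_mul]
      have hfvc : ρ G.f *ᵥ (fun i => v i * c) = fun i => v i * c := by
        ext i
        rw [hf, vecMulVec_self_star_mulVec, hvc]
      rw [hfvc, hvc]
  let σ₀ : G.S →ₗ[ℝ] (Fin N → F) :=
    { toFun ψ := ρ (ψ : Cl p q) *ᵥ v
      map_add' ψ φ := by
        change ρ ((ψ : Cl p q) + φ) *ᵥ v = _
        rw [map_add, Matrix.add_mulVec]
      map_smul' r ψ := by
        change ρ (r • (ψ : Cl p q)) *ᵥ v = r • _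
        rw [map_smul, Matrix.smul_mulVec] }
  have hσ : Function.Bijective σ₀ := by
    constructor
    · rw [injective_iff_map_eq_zero]
      exact fun ψ hψ => Subtype.ext (hdet ψ (G.mul_f ψ) hψ)
    · intro x
      obtain ⟨u, hu⟩ := hsurj (vecMulVec x (star v))
      refine ⟨⟨u * G.f, Ideal.mem_span_singleton'.2 ⟨u, rfl⟩⟩, ?_⟩
      change ρ (u * G.f) *ᵥ v = x
      rw [map_mul, ← Matrix.mulVec_mulVec, hfv, hu, Matrix.vecMulVec_mulVec, hv,
        MulOpposite.op_one, one_smul]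
  refine ⟨{
    κ := RingEquiv.ofBijective κ₀ hκ
    κ_smul := fun r a b hab => ?_
    σ := LinearEquiv.ofBijective σ₀ hσ
    σ_rsmul := fun ψ a i => ?_
    σ_smul := fun u ψ => ?_
    κ_prod := fun ψ φ => ?_ }⟩
  · change star v ⬝ᵥ (ρ b.1 *ᵥ v) = r • (star v ⬝ᵥ (ρ a.1 *ᵥ v))
    rw [hab, map_smul, Matrix.smul_mulVec, dotProduct_smul]
  · change (ρ ((ψ : Cl p q) * a.1) *ᵥ v) i = _
    rw [map_mul, ← Matrix.mulVec_mulVec, hmulK]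
    rfl
  · change ρ (u * (ψ : Cl p q)) *ᵥ v = ρ u *ᵥ (ρ (ψ : Cl p q) *ᵥ v)
    rw [map_mul, ← Matrix.mulVec_mulVec]
  · change star v ⬝ᵥ (ρ (transp (ψ : Cl p q) * (φ : Cl p q)) *ᵥ v) =
      star (ρ (ψ : Cl p q) *ᵥ v) ⬝ᵥ (ρ (φ : Cl p q) *ᵥ v)
    rw [map_mul, hT, ← Matrix.mulVec_mulVec, Matrix.star_mulVec, ← Matrix.dotProduct_mulVec]
    rfl

/-- If `u` maps `S` into the orthogonal complement of `S`, then it acts by zero, since the standard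
Hermitian form is nondegenerate. -/
theorem Coordinates.eq_zero_of_prod {G : SpinorIdempotent p q}
    {ρ : Cl p q →ₐ[ℝ] Matrix (Fin N) (Fin N) F} (C : G.Coordinates ρ) {u : Cl p q}
    (h : ∀ ψ φ : G.S, G.prod ψ (u • φ) = 0) : ρ u = 0 := by
  ext i j
  have h1 := C.κ_prod (C.σ.symm (Pi.single i 1)) (u • C.σ.symm (Pi.single j 1))
  rw [h, map_zero, C.σ_smul, C.σ.apply_symm_apply, C.σ.apply_symm_apply] at h1
  simpa using h1.symm

end SpinorIdempotent

/-! ### The orthogonal and symplectic groups -/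

namespace IsSpinorModel

variable {p q N : ℕ} {F : Type} [Ring F] [StarRing F] [Algebra ℝ F]
  {Φ : Cl p q ≃ₐ[ℝ] Matrix (Fin N) (Fin N) F × Matrix (Fin N) (Fin N) F}

/-- The two matrix factors of a model may be exchanged; `-c` then takes the place of the odd central
element `c`. -/
theorem swap (hΦ : IsSpinorModel Φ) : IsSpinorModel (Φ.trans
    (AlgEquiv.ofRingEquiv (R := ℝ) (f := RingEquiv.prodComm) fun _ => rfl)) where
  map_transp u := by
    change (Φ _).swap = _
    rw [hΦ.map_transp]; rfl
  odd := by
    obtain ⟨c, hc, hc'⟩ := hΦ.odd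
    refine ⟨-c, ?_, by rw [map_neg, hc']⟩
    change (Φ (-c)).swap = _
    rw [map_neg, hc]
    simp

theorem mem_geps_iff (hΦ : IsSpinorModel Φ) (g : Cl p q) :
    g ∈ Geps p q ↔ star (Φ g).1 * (Φ g).1 = 1 ∧ star (Φ g).2 * (Φ g).2 = 1 := by
  change CliffordTransposition.transp g * g = 1 ↔ _
  rw [← Φ.injective.eq_iff, map_mul, hΦ.map_transp, map_one, Prod.ext_iff]
  rfl

theorem map_geps (hΦ : IsSpinorModel Φ) {H : Submonoid (Matrix (Fin N) (Fin N) F)}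
    (hH : ∀ A, A ∈ H ↔ star A * A = 1) : (Geps p q).map Φ = H.prod H := by
  ext x
  obtain ⟨g, rfl⟩ := Φ.surjective x
  rw [Submonoid.mem_map, Submonoid.mem_prod, hH, hH, ← hΦ.mem_geps_iff]
  exact ⟨fun ⟨y, hy, h⟩ => Φ.injective h ▸ hy, fun h => ⟨g, h, rfl⟩⟩

/-- The group isomorphism `G^ε ≃ H × H` that a matrix model induces. -/
def gepsEquiv (hΦ : IsSpinorModel Φ) {H : Submonoid (Matrix (Fin N) (Fin N) F)}
    (hH : ∀ A, A ∈ H ↔ star A * A = 1) : Geps p q ≃* H × H :=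
  let φ : Cl p q →* Matrix (Fin N) (Fin N) F × Matrix (Fin N) (Fin N) F :=
    MonoidHomClass.toMonoidHom Φ
  have hφ : (Geps p q).map φ = H.prod H := hΦ.map_geps hH
  ((Geps p q).equivMapOfInjective φ Φ.injective).trans
    ((MulEquiv.submonoidCongr hφ).trans (Submonoid.prodEquiv H H))

/-- Since the central element `(1, -1)` is odd, the grade involution moves an idempotent from the
first matrix factor to the second. -/
theorem hat_fst_eq_zero (hΦ : IsSpinorModel Φ) (G : SpinorIdempotent p q) (h0 : (Φ G.f).2 = 0) :
    (Φ G.hat.f).1 = 0 := by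
  obtain ⟨c, hc, hc'⟩ := hΦ.odd
  have h1 : c * G.f = G.f := Φ.injective (by
    rw [map_mul, hc]; ext1 <;> simp [h0])
  have h2 : -c * G.hat.f = G.hat.f := by
    have := congrArg CliffordAlgebra.involute h1
    rwa [map_mul, hc'] at this
  have h3 : -(Φ G.hat.f).1 = (Φ G.hat.f).1 := by
    have := congrArg (fun u => (Φ u).1) h2
    simpa [hc] using this
  have h4 : (2 : ℝ) • (Φ G.hat.f).1 = 0 := by
    rw [two_smul]; nth_rw 1 [← h3]; exact neg_add_cancel _
  exact (smul_eq_zero.1 h4).resolve_left two_ne_zero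

/-- The rank one projection onto a coordinate axis of the first factor is a spinor idempotent. -/
theorem nonempty_spinorIdempotent [IsDomain F] (hΦ : IsSpinorModel Φ) (hN : 0 < N) :
    Nonempty (SpinorIdempotent p q) := by
  set v : Fin N → F := Pi.single ⟨0, hN⟩ 1 with hv
  have hv1 : star v ⬝ᵥ v = 1 := by simp [hv]
  refine ⟨⟨Φ.symm (vecMulVec v (star v), 0),
    (isPrimitiveIdempotent_vecMulVec hv1).prod_zero.map_equiv Φ.symm.toRingEquiv,
    Φ.injective ?_⟩⟩
  rw [hΦ.map_transp, Φ.apply_symm_apply]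
  exact Prod.ext (star_vecMulVec_self_star v) (star_zero _)

variable [IsDomain F] [StarModule ℝ F]

theorem nonempty_coordinates_fst (hΦ : IsSpinorModel Φ) (hF : IsPositiveStar F)
    (G : SpinorIdempotent p q) (h0 : (Φ G.f).2 = 0) :
    Nonempty (G.Coordinates ((AlgHom.fst ℝ _ _).comp Φ.toAlgHom)) := by
  have hst : star (Φ G.f) = Φ G.f := by rw [← hΦ.map_transp, G.transp_f]
  have hprim : IsPrimitiveIdempotent (Φ G.f).1 := by
    rcases (G.primitive.map_equiv Φ.toRingEquiv).fst_or_snd with h | h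
    · exact h.1
    · exact absurd h0 h.2.2.1
  obtain ⟨v, hv, hfv⟩ := hprim.exists_eq_vecMulVec hF (congrArg Prod.fst hst)
  refine G.nonempty_coordinates _ (fun u => ?_) (fun X => ?_) (fun u hu hu0 => ?_) hv hfv
  · exact congrArg Prod.fst (hΦ.map_transp u)
  · obtain ⟨u, hu⟩ := Φ.surjective (X, 0)
    exact ⟨u, congrArg Prod.fst hu⟩
  · refine Φ.injective ?_
    rw [map_zero]
    refine Prod.ext hu0 ?_
    rw [← hu, map_mul]
    change (Φ u).2 * (Φ G.f).2 = 0
    rw [h0, mul_zero]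

theorem spinorGroupIs_of_snd_eq_zero (hΦ : IsSpinorModel Φ) (hF : IsPositiveStar F)
    {H : Submonoid (Matrix (Fin N) (Fin N) F)} (hH : ∀ A, A ∈ H ↔ star A * A = 1)
    (G : SpinorIdempotent p q) (h0 : (Φ G.f).2 = 0) : SpinorGroupIs G F H :=
  ⟨Φ, hΦ.nonempty_coordinates_fst hF G h0,
    hΦ.swap.nonempty_coordinates_fst hF G.hat (hΦ.hat_fst_eq_zero G h0), hΦ.map_geps hH⟩

/-- A primitive idempotent lies in one of the two matrix factors, and after exchanging the factors
it lies in the first one. -/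
theorem spinorGroupIs (hΦ : IsSpinorModel Φ) (hF : IsPositiveStar F)
    {H : Submonoid (Matrix (Fin N) (Fin N) F)} (hH : ∀ A, A ∈ H ↔ star A * A = 1)
    (G : SpinorIdempotent p q) : SpinorGroupIs G F H := by
  rcases (G.primitive.map_equiv Φ.toRingEquiv).fst_or_snd with h | h
  · exact hΦ.spinorGroupIs_of_snd_eq_zero hF hH G h.2
  · exact hΦ.swap.spinorGroupIs_of_snd_eq_zero hF hH G h.1

end IsSpinorModel

/-- If left multiplication by `g` preserves both products, then `T(g) g - 1` acts by zero on `S` and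
on `Ŝ`, hence vanishes, because the two spinor representations are jointly faithful. -/
theorem SpinorGroupIs.mem_geps_iff {p q N : ℕ} {F : Type} [Ring F] [StarRing F] [Algebra ℝ F]
    {G : SpinorIdempotent p q} {H : Submonoid (Matrix (Fin N) (Fin N) F)}
    (h : SpinorGroupIs G F H) (g : Cl p q) :
    g ∈ Geps p q ↔ ∀ ψ φ : G.S × G.hat.S, G.spinorProd (g • ψ) (g • φ) = G.spinorProd ψ φ := by
  have hexp : ∀ (G' : SpinorIdempotent p q) (ψ φ : G'.S),
      (G'.prod (g • ψ) (g • φ)).1 = transp (ψ : Cl p q) * (transp g * g * φ) := by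
    intro G' ψ φ
    change transp (g * (ψ : Cl p q)) * (g * (φ : Cl p q)) = _
    rw [transp_mul]; simp only [mul_assoc]
  constructor
  · intro hg ψ φ
    have hg' : transp g * g = 1 := hg
    refine Prod.ext (Subtype.ext ?_) (Subtype.ext ?_)
    · refine (hexp _ _ _).trans ?_
      rw [hg', one_mul]; rfl
    · refine (hexp _ _ _).trans ?_
      rw [hg', one_mul]; rfl
  · intro hg
    obtain ⟨Φ, ⟨C₁⟩, ⟨C₂⟩, -⟩ := h
    have key : ∀ (G' : SpinorIdempotent p q) (ψ φ : G'.S),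
        G'.prod (g • ψ) (g • φ) = G'.prod ψ φ → G'.prod ψ ((transp g * g - 1) • φ) = 0 := by
      intro G' ψ φ h
      refine Subtype.ext ?_
      change transp (ψ : Cl p q) * ((transp g * g - 1) * φ) = 0
      rw [sub_mul, one_mul, mul_sub, ← hexp, h]
      exact sub_self _
    have h1 := C₁.eq_zero_of_prod fun ψ φ =>
      key _ ψ φ (congrArg Prod.fst (hg (ψ, 0) (φ, 0)))
    have h2 := C₂.eq_zero_of_prod fun ψ φ =>
      key _ ψ φ (congrArg Prod.snd (hg (0, ψ) (0, φ)))
    have h3 : Φ (transp g * g - 1) = Φ 0 := by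
      rw [map_zero]; exact Prod.ext h1 h2
    exact sub_eq_zero.1 (Φ.injective h3)

instance : StarModule ℝ ℍ[ℝ] := ⟨fun r x => Quaternion.star_smul r x⟩

theorem isPositiveStar_real : IsPositiveStar ℝ := fun x => ⟨x * x, mul_self_nonneg x, rfl⟩

theorem isPositiveStar_quaternion : IsPositiveStar ℍ[ℝ] :=
  fun x => ⟨Quaternion.normSq x, Quaternion.normSq_nonneg, Quaternion.star_mul_self x⟩

theorem mem_unitary_matrix_iff {F : Type} [Ring F] [StarRing F] [IsStablyFiniteRing F] {N : ℕ}
    (A : Matrix (Fin N) (Fin N) F) :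
    A ∈ unitary (Matrix (Fin N) (Fin N) F) ↔ star A * A = 1 :=
  ⟨fun h => h.1, fun h => ⟨h, mul_eq_one_symm h⟩⟩

theorem kNum_real {p q : ℕ} (h : (p : ℤ) - q ≡ 1 [ZMOD 8]) : 2 * kNum p q - 1 = p + q := by
  unfold Int.ModEq at h
  unfold kNum radonHurwitz
  rw [if_neg (by omega), if_neg (by omega), if_neg (by omega)]
  omega

theorem kNum_quaternion {p q : ℕ} (h : (p : ℤ) - q ≡ 5 [ZMOD 8]) :
    2 * kNum p q + 1 = p + q := by
  unfold Int.ModEq at h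
  unfold kNum radonHurwitz
  rw [if_neg (by omega), if_neg (by omega), if_pos (by omega)]
  omega

theorem exists_model_real {p q : ℕ} (h : (p : ℤ) - q ≡ 1 [ZMOD 8]) :
    ∃ Φ : Cl p q ≃ₐ[ℝ] Matrix (Fin (NNum p q)) (Fin (NNum p q)) ℝ ×
      Matrix (Fin (NNum p q)) (Fin (NNum p q)) ℝ, IsSpinorModel Φ := by
  refine (HasMatrixSystem.induction (R := HasMatrixSystem ℝ) (Or.inl rfl) (fun _ => .real)
    (by norm_num) (fun _ _ => .double) (fun _ _ => .twist) (fun _ _ => .flipFour) p q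
    h).exists_model ?_
  have hk := kNum_real h
  have : p + q = 1 + (kNum p q - 1).toNat * 2 := by omega
  rw [this, NNum, pow_add, pow_mul, Module.finrank_self]
  ring

theorem exists_model_quaternion {p q : ℕ} (h : (p : ℤ) - q ≡ 5 [ZMOD 8]) :
    ∃ Φ : Cl p q ≃ₐ[ℝ] Matrix (Fin (NNum p q)) (Fin (NNum p q)) ℍ[ℝ] ×
      Matrix (Fin (NNum p q)) (Fin (NNum p q)) ℍ[ℝ], IsSpinorModel Φ := by
  refine (HasMatrixSystem.induction (R := HasMatrixSystem ℍ[ℝ]) (Or.inr rfl) (by norm_num)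
    (fun _ => .quaternion) (fun _ _ => .double) (fun _ _ => .twist) (fun _ _ => .flipFour) p q
    h).exists_model ?_
  have hk := kNum_quaternion h
  unfold Int.ModEq at h
  have : p + q = 3 + (kNum p q - 1).toNat * 2 := by omega
  rw [this, NNum, pow_add, pow_mul, Quaternion.finrank_eq_four]
  ring

end CliffordTransposition

end

theorem mainTheorem2 (p q : ℕ) (hpq : (p : ℤ) - q ≡ 1 [ZMOD 4]) :
    1 ≤ CliffordTransposition.kNum p q ∧
    ((p : ℤ) - q ≡ 1 [ZMOD 8] →
      Nonempty (CliffordTransposition.Geps p q ≃*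
        CliffordTransposition.O (CliffordTransposition.NNum p q) ×
          CliffordTransposition.O (CliffordTransposition.NNum p q))) ∧
    ((p : ℤ) - q ≡ 5 [ZMOD 8] →
      Nonempty (CliffordTransposition.Geps p q ≃*
        CliffordTransposition.Sp (CliffordTransposition.NNum p q) ×
          CliffordTransposition.Sp (CliffordTransposition.NNum p q))) ∧
    Nonempty (CliffordTransposition.SpinorIdempotent p q) ∧
    ∀ F : CliffordTransposition.SpinorIdempotent p q,
      (∀ g : CliffordTransposition.Cl p q, g ∈ CliffordTransposition.Geps p q ↔
        ∀ ψ φ : F.S × F.hat.S, F.spinorProd (g • ψ) (g • φ) = F.spinorProd ψ φ) ∧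
      ((p : ℤ) - q ≡ 1 [ZMOD 8] →
        CliffordTransposition.SpinorGroupIs F ℝ
          (CliffordTransposition.O (CliffordTransposition.NNum p q))) ∧
      ((p : ℤ) - q ≡ 5 [ZMOD 8] →
        CliffordTransposition.SpinorGroupIs F ℍ[ℝ]
          (CliffordTransposition.Sp (CliffordTransposition.NNum p q))) := by
  have hN : 0 < CliffordTransposition.NNum p q := by
    unfold CliffordTransposition.NNum; positivity
  have hcase : (p : ℤ) - q ≡ 1 [ZMOD 8] ∨ (p : ℤ) - q ≡ 5 [ZMOD 8] := by
    unfold Int.ModEq at *; omega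
  rcases hcase with h | h
  · have h5 : ¬ (p : ℤ) - q ≡ 5 [ZMOD 8] := by unfold Int.ModEq at *; omega
    obtain ⟨Φ, hΦ⟩ := CliffordTransposition.exists_model_real h
    have hG := hΦ.spinorGroupIs
      CliffordTransposition.isPositiveStar_real CliffordTransposition.mem_unitary_matrix_iff
    have hk := CliffordTransposition.kNum_real h
    exact ⟨by omega, fun _ => ⟨hΦ.gepsEquiv CliffordTransposition.mem_unitary_matrix_iff⟩,
      fun h' => absurd h' h5,
      hΦ.nonempty_spinorIdempotent hN,
      fun G => ⟨(hG G).mem_geps_iff, fun _ => hG G, fun h' => absurd h' h5⟩⟩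
  · have h1 : ¬ (p : ℤ) - q ≡ 1 [ZMOD 8] := by unfold Int.ModEq at *; omega
    obtain ⟨Φ, hΦ⟩ := CliffordTransposition.exists_model_quaternion h
    have hG := hΦ.spinorGroupIs
      CliffordTransposition.isPositiveStar_quaternion CliffordTransposition.mem_unitary_matrix_iff
    have hk := CliffordTransposition.kNum_quaternion h
    exact ⟨by unfold Int.ModEq at *; omega, fun h' => absurd h' h1,
      fun _ => ⟨hΦ.gepsEquiv CliffordTransposition.mem_unitary_matrix_iff⟩,
      hΦ.nonempty_spinorIdempotent hN,
      fun G => ⟨(hG G).mem_geps_iff, fun h' => absurd h' h1, fun _ => hG G⟩⟩
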